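/- A directed graph has an irreflexive, asymmetric edge relation $E$. It is \emph{complete multipartite} if the relation "no edge in either direction between $x$ and $y$" is an equivalence relation; its classes are called \emph{parts}, and the graph is $k$-partite if it has exactly $k$ parts. Let $\mathcal S$ be the class of all finite complete multipartite directed graphs such that for any two distinct parts $P,P'$, distinct $u,v\in P$ and distinct $x,y\in P'$, the number of edges directed from $\{u,v\}$ to $\{x,y\}$ is even (the semigeneric directed graph is the Fraïssé limit of $\mathcal S$). Let $\mathcal S^*$ be the class of all structures $\mathbf A^*=(A,E,R,<)$, with $R$ and $<$ binary relations, that arise as follows. Let $\mathbf A=(A,E)\in\mathcal S$ be $k$-partite. Take a $k$-partite $\bar{\mathbf A}\in\mathcal S$ on the disjoint union of $A$ and $T=\{t_0,\dots,t_{k-1}\}$ that induces $\mathbf A$ on $A$ and in which, on $T$, there is an edge from $t_i$ to $t_j$ iff $i<j$ (so $T$ has exactly one point in each part). For $x,u\in A$, put $R(x,u)$ iff $x$ and $u$ lie in different parts and, for the point $t_i$ of $T$ in the part of $x$, there is an edge of $\bar{\mathbf A}$ from $t_i$ to $u$. Let $<$ be the restriction to $A$ of a linear order on $A\cup T$ that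 satisfies $t_0<\dots<t_{k-1}$ and for which every part of $\bar{\mathbf A}$ is convex. \textbf{Theorem.} The age of $\mathcal S^*$, that is, the class $\mathcal K$ of all finite structures that embed into a member of $\mathcal S^*$, has the Ramsey property: for every $r\in\mathbb N$ and all $\mathbf A,\mathbf B\in\mathcal K$ there is $\mathbf C\in\mathcal K$ such that for every colouring with $r$ colours of the substructures of $\mathbf C$ isomorphic to $\mathbf A$, there is a substructure $\mathbf B'$ of $\mathbf C$ isomorphic to $\mathbf B$ such that all substructures of $\mathbf B'$ isomorphic to $\mathbf A$ have the same colour. -/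

import Mathlib

open CategoryTheory
open scoped FirstOrder

namespace Semigeneric

/-! ### The Ramsey property of a class of structures -/

section Ramsey

universe u v w

variable {L : FirstOrder.Language.{u, v}}

/-- The copies of `A` in `C`: the substructures of `C` that are isomorphic to `A`. -/
def Copies (L : FirstOrder.Language.{u, v}) (C A : Type w) [L.Structure C] [L.Structure A] : Type w :=
  {D : L.Substructure C // Nonempty (D ≃[L] A)}

/-- The partition relation `C → (B)^A_k`: every colouring with `k` colours of the copies of `A`
in `C` is constant on the copies of `A` contained in some copy of `B` in `C`. -/
def Arrows (L : FirstOrder.Language.{u, v}) (C B A : Type w) [L.Structure C] [L.Structure B]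
    [L.Structure A] (k : ℕ) : Prop :=
  ∀ c : Copies L C A → Fin k, ∃ D : Copies L C B,
    ∀ A₁ A₂ : Copies L C A, A₁.1 ≤ D.1 → A₂.1 ≤ D.1 → c A₁ = c A₂

/-- The Ramsey property of a class of structures. -/
def HasRamseyProperty (K : Set (Bundled.{w} L.Structure)) : Prop :=
  ∀ k : ℕ, ∀ A ∈ K, ∀ B ∈ K, ∃ C ∈ K, Arrows L C B A k

/-- The age of a class of structures: the finite structures that embed into a member of it. -/
def ageOfClass (K : Set (Bundled.{w} L.Structure)) : Set (Bundled.{w} L.Structure) :=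
  {A | Finite A ∧ ∃ B ∈ K, Nonempty (A ↪[L] B)}

end Ramsey

/-! ### The class of finite semigeneric directed graphs -/

section Digraphs

universe u

variable {V : Type u}

/-- The non-edge relation of a directed graph. -/
def NonEdge (G : Digraph V) (x y : V) : Prop := ¬ G.Adj x y ∧ ¬ G.Adj y x

/-- A complete multipartite directed graph: edges are asymmetric (hence there are no loops) and
the non-edge relation is an equivalence relation. Its classes are the parts of the graph. -/
structure IsCompleteMultipartite (G : Digraph V) : Prop where
  asymm : ∀ x y, G.Adj x y → ¬ G.Adj y x
  equiv : Equivalence (NonEdge G)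

/-- The parity constraint: if `u ≠ v` lie in one part and `x ≠ y` lie in another one, then the
number of edges directed from `{u, v}` to `{x, y}` is even. -/
def ParityConstraint (G : Digraph V) : Prop :=
  ∀ u v x y : V, u ≠ v → x ≠ y → NonEdge G u v → NonEdge G x y → ¬ NonEdge G u x →
    Even (Set.ncard {e : V × V | (e.1 = u ∨ e.1 = v) ∧ (e.2 = x ∨ e.2 = y) ∧ G.Adj e.1 e.2})

/-- Membership in the class `𝒮`, whose Fraïssé limit is the semigeneric directed graph. -/
structure InS (G : Digraph V) : Prop where
  finite : Finite V
  multipartite : IsCompleteMultipartite G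
  parity : ParityConstraint G

/-- The graph `G` has exactly `k` parts. -/
def IsPartite (G : Digraph V) (k : ℕ) : Prop :=
  ∃ part : V → Fin k, Function.Surjective part ∧ ∀ x y, NonEdge G x y ↔ part x = part y

/-- The binary relation `lt` is a strict linear order for which each part of `G` is convex. -/
structure IsConvexLinearOrder (G : Digraph V) (lt : V → V → Prop) : Prop where
  irrefl : ∀ x, ¬ lt x x
  trans : ∀ x y z, lt x y → lt y z → lt x z
  total : ∀ x y, lt x y ∨ x = y ∨ lt y x
  convex : ∀ x y z, lt x y → lt y z → NonEdge G x z → NonEdge G x y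

/-- The pair `(R, lt)` is an admissible expansion of the `k`-partite graph `G` in `𝒮`: there are a
`k`-partite graph `H` in `𝒮` on the disjoint union of the vertex set of `G` and of a transversal
`t_0, …, t_(k-1)` (here `t_i` is `Sum.inr i`), with `G` and the linearly ordered tournament
`{t_0, …, t_(k-1)}` as induced subgraphs, and a convex linear order `ltH` of `H` with
`t_0 < … < t_(k-1)`, such that `lt` is the restriction of `ltH` and, for `x` and `u` in different
parts of `G`, `R x u` says that the edge between `u` and the point of the transversal in the part
of `x` is directed towards `u`. -/
def IsExpansion (G : Digraph V) (R lt : V → V → Prop) (k : ℕ) : Prop :=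
  InS G ∧ IsPartite G k ∧
  ∃ (H : Digraph (V ⊕ Fin k)) (ltH : V ⊕ Fin k → V ⊕ Fin k → Prop),
    InS H ∧ IsPartite H k ∧
    (∀ x y : V, H.Adj (Sum.inl x) (Sum.inl y) ↔ G.Adj x y) ∧
    (∀ i j : Fin k, H.Adj (Sum.inr i) (Sum.inr j) ↔ i < j) ∧
    (∀ x u : V, R x u ↔ ¬ NonEdge G x u ∧
      ∃ i : Fin k, NonEdge H (Sum.inr i) (Sum.inl x) ∧ H.Adj (Sum.inr i) (Sum.inl u)) ∧
    IsConvexLinearOrder H ltH ∧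
    (∀ i j : Fin k, i < j → ltH (Sum.inr i) (Sum.inr j)) ∧
    (∀ x y : V, lt x y ↔ ltH (Sum.inl x) (Sum.inl y))

end Digraphs

/-! ### The class `𝒮*` of expanded structures -/

/-- The three binary relation symbols `E` (edges), `R` and `<` of the expanded language. -/
inductive StarRel : ℕ → Type
  | edge : StarRel 2
  | sub : StarRel 2
  | lt : StarRel 2

/-- The relational language `{E, R, <}`. -/
def starLang : FirstOrder.Language.{0, 0} := ⟨fun _ => Empty, StarRel⟩

instance : starLang.IsRelational := fun _ => inferInstanceAs (IsEmpty Empty)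

section Interpretation

universe u

variable (A : Type u) [starLang.Structure A]

/-- The directed graph given by the interpretation of `E`. -/
def edgeGraph : Digraph A where
  Adj x y := FirstOrder.Language.Structure.RelMap (L := starLang) StarRel.edge ![x, y]

/-- The interpretation of `R`. -/
def subRel (x u : A) : Prop := FirstOrder.Language.Structure.RelMap (L := starLang) StarRel.sub ![x, u]

/-- The interpretation of `<`. -/
def ltRel (x y : A) : Prop := FirstOrder.Language.Structure.RelMap (L := starLang) StarRel.lt ![x, y]

end Interpretation

/-- The class `𝒮*`: all `(A, E, R, <)` such that `(R, <)` is an admissible expansion of the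
directed graph `(A, E)`, which belongs to `𝒮` and has some finite number `k` of parts. -/
def SStar : Set (Bundled.{0} starLang.Structure) :=
  {A | ∃ k : ℕ, IsExpansion (edgeGraph A) (subRel A) (ltRel A) k}

end Semigeneric

/-!
In an expanded graph, `R x u` depends on `x` only through its part, so each point carries a label
for every part other than its own. By the parity constraint, the edges are determined by the labels
and the order, and conversely all labels are possible (`IsExpansion.isStarModel`,
`isExpansion_labelGraph`). Hence the class is closed under substructures and amounts to a class of
convexly ordered sets of points with labels.

The Ramsey property is derived from the Graham–Rothschild theorem on parameter words
(`ParamWord.graham_rothschild`), itself derived from the Hales–Jewett theorem. The set of all words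
of length `N` over the alphabet `{0, 1, 2}` becomes a member of the class when the part of a word is
given by the positions of its letters `0`, `R x u` says that at some position `x` has the letter `0`
and `u` the letter `1` while `x` and `u` lie in different parts, and words are ordered
lexicographically, first by parts and then by letters.
Substitution into a parameter word preserves all of this, since constants never create a pair of
letters `0` and `1` (`actEmbedding`).

A finite structure is represented by words whose positions run through all nonconstant assignments
of letters to its points that are compatible with parts and `R`, listed in a colexicographic order.
Each such assignment on a substructure has a least extension (`exists_isGood_extension`). Therefore,
in the list for `B` restricted to a copy of `A`, the assignments on `A` make their first occurrences
in the order of the list for `A`. This means that every copy of `A` in `B` arises from the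
representation of `A` by substitution into a parameter word (`exists_codes`), so a parameter word on
which the Graham–Rothschild theorem makes the colouring constant turns the representation of `B`
into the desired copy of `B`.
-/

namespace Semigeneric

/-! ### Parameter words -/

/-- `ParamWord α n m` is the type of words of length `n` over the alphabet `α` with `m` parameters:
each parameter occurs, and the first occurrences of the parameters come in their natural order.
The word is read from the left. `cons a w` starts with the letter `a`; `new w` starts with the
first occurrence of the first parameter, which afterwards is treated as one more letter, so that
`w` is a word with one parameter less over the alphabet `Option α`, where `none` stands for this
parameter. -/
inductive ParamWord : Type → ℕ → ℕ → Type 1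
  | nil {α : Type} : ParamWord α 0 0
  | cons {α : Type} {n m : ℕ} (a : α) (w : ParamWord α n m) : ParamWord α (n + 1) m
  | new {α : Type} {n m : ℕ} (w : ParamWord (Option α) n m) : ParamWord α (n + 1) (m + 1)

namespace ParamWord

variable {α β γ : Type} {N n m k : ℕ}

/-- Replaces the letters of a parameter word and keeps its parameters. -/
def map : {α β : Type} → {n m : ℕ} → (α → β) → ParamWord α n m → ParamWord β n m
  | _, _, _, _, _, nil => nil
  | _, _, _, _, f, cons a w => cons (f a) (map f w)
  | _, _, _, _, f, new w => new (map (Option.map f) w)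

/-- Substitution of the entries of `v` for the parameters of `w`, with `f` applied to the letters
of `w`. For `f = id` this is the composition of parameter words. -/
def subst : {α β : Type} → {N n m : ℕ} → (α → β) → ParamWord α N n → ParamWord β n m →
    ParamWord β N m
  | _, _, _, _, _, _, nil, v => v
  | _, _, _, _, _, f, cons a w, v => cons (f a) (subst f w v)
  | _, _, _, _, _, f, new w, cons b v => cons b (subst (fun o => o.elim b f) w v)
  | _, _, _, _, _, f, new w, new v => new (subst (Option.map f) w v)

theorem map_id' {f : α → α} (hf : ∀ a, f a = a) (w : ParamWord α n m) : map f w = w := by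
  induction w with
  | nil => rfl
  | cons a w ih => simp [map, hf, ih hf]
  | new w ih => rw [map, ih]; intro o; cases o <;> simp [hf]

theorem map_map (f : α → β) (g : β → γ) (w : ParamWord α n m) :
    map g (map f w) = map (g ∘ f) w := by
  induction w generalizing β γ with
  | nil => rfl
  | cons a w ih => simp [map, ih]
  | new w ih => simp [map, ih, Option.map_comp_map]

theorem subst_map (f : α → β) (g : β → γ) (w : ParamWord α N n) (v : ParamWord γ n m) :
    subst g (map f w) v = subst (g ∘ f) w v := by
  induction w generalizing β γ m with
  | nil => rfl
  | cons a w ih => simp [map, subst, ih]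
  | new w ih =>
    cases v with
    | cons b v =>
      simp only [map, subst, ih]
      congr 2
      funext o; cases o <;> rfl
    | new v => simp [map, subst, ih, Option.map_comp_map]

theorem map_subst (f : α → β) (g : β → γ) (w : ParamWord α N n) (v : ParamWord β n m) :
    map g (subst f w v) = subst (g ∘ f) w (map g v) := by
  induction w generalizing β γ m with
  | nil => rfl
  | cons a w ih => simp [map, subst, ih]
  | new w ih =>
    cases v with
    | cons b v =>
      simp only [map, subst, ih]
      congr 2
      funext o; cases o <;> rfl
    | new v => simp [map, subst, ih, Option.map_comp_map]

/-- Associativity of the composition of parameter words. -/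
theorem subst_subst (f : α → β) (g : β → γ) (w : ParamWord α N n) (v : ParamWord β n m)
    (s : ParamWord γ m k) :
    subst g (subst f w v) s = subst (g ∘ f) w (subst g v s) := by
  induction w generalizing β γ m k with
  | nil => rfl
  | cons a w ih => simp [subst, ih]
  | new w ih =>
    cases v with
    | cons b v =>
      simp only [subst, ih]
      congr 2
      funext o; cases o <;> rfl
    | new v =>
      cases s with
      | cons b s =>
        simp only [subst, ih]
        congr 2
        funext o; cases o <;> rfl
      | new s => simp [subst, ih, Option.map_comp_map]

/-! ### The Graham–Rothschild theorem -/

instance finite [Finite α] : Finite (ParamWord α n m) := by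
  induction n generalizing α m with
  | zero =>
    refine @Finite.of_injective _ Unit _ (fun _ => ()) ?_
    intro a b _
    cases a; cases b; rfl
  | succ n ih =>
    cases m with
    | zero =>
      refine Finite.of_surjective
        (fun p : α × ParamWord α n 0 => (cons p.1 p.2 : ParamWord α (n + 1) 0)) ?_
      intro w
      cases w with
      | cons a w => exact ⟨(a, w), rfl⟩
    | succ m =>
      refine Finite.of_surjective (fun p : (α × ParamWord α n (m + 1)) ⊕ ParamWord (Option α) n m =>
        (Sum.elim (fun q => cons q.1 q.2) new p : ParamWord α (n + 1) (m + 1))) ?_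
      intro w
      cases w with
      | cons a w => exact ⟨Sum.inl (a, w), rfl⟩
      | new w => exact ⟨Sum.inr w, rfl⟩

/-- The position of the first occurrence of the first parameter (the length of the word, if there
are no parameters). -/
def firstPos : {α : Type} → {n m : ℕ} → ParamWord α n m → ℕ
  | _, _, _, nil => 0
  | _, _, _, cons _ w => firstPos w + 1
  | _, _, _, new _ => 0

/-- Puts the constant word `u i₁, …, u iₖ`, for `e = [i₁, …, iₖ]`, in front of a parameter word. -/
def app {ι : Type} (u : ι → α) : (e : List ι) → ParamWord α n m → ParamWord α (n + e.length) m
  | [], w => w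
  | i :: e, w => cons (u i) (app u e w)

theorem subst_app {ι : Type} (u : ι → α) (e : List ι) (f : α → β) (w : ParamWord α N n)
    (v : ParamWord β n m) : subst f (app u e w) v = app (f ∘ u) e (subst f w v) := by
  induction e with
  | nil => rfl
  | cons i e ih => simp [app, subst, ih]

/-- A combinatorial line `l`, given by its coordinates in `Option α` (`none` is the moving
coordinate), can be put in front of a word `w` over `Option α`: its first moving coordinate becomes
the first occurrence of a new parameter, and the letter `none` of `w` becomes further occurrences of
it. Substituting a letter `a` for that parameter yields the point `l a` of the line, followed by `w`
with `a` in place of `none`. -/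
theorem exists_lineApp {ι : Type} (l : ι → Option α) (e : List ι) (h : ∃ i ∈ e, l i = none) :
    ∃ P : ∀ {n m : ℕ}, ParamWord (Option α) n m → ParamWord α (n + e.length) (m + 1),
      (∀ {N n m : ℕ} (w : ParamWord (Option α) N n) (s : ParamWord (Option α) n m),
        subst id (P w) (new s) = P (subst id w s)) ∧
      (∀ {N n m : ℕ} (w : ParamWord (Option α) N n) (a : α) (s : ParamWord α n m),
        subst id (P w) (cons a s) =
          app (fun i => (l i).getD a) e (subst (fun o => o.getD a) w s)) := by
  induction e with
  | nil => simp at h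
  | cons i e ih =>
    cases hl : l i with
    | none =>
      refine ⟨fun w => new (app l e w), ?_, ?_⟩
      · intro N n m w s
        simp [subst, subst_app]
      · intro N n m w a s
        have : (fun o : Option α => o.elim a id) = fun o => o.getD a := by
          funext o; cases o <;> rfl
        simp only [subst, this, subst_app, app, hl]
        rfl
    | some x =>
      obtain ⟨P, h1, h2⟩ := ih (by simpa [hl] using h)
      refine ⟨fun w => cons x (P w), ?_, ?_⟩
      · intro N n m w s
        simp [subst, h1]
      · intro N n m w a s
        simp [subst, h2, app, hl]

/-- If at least `n` of the positions below `N` belong to `S`, then `N` parameters can be specialized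
to `n` parameters so that first occurrences of the first parameter come to lie in `S`: the entries
at positions outside `S` are set to a constant. -/
theorem exists_subst_firstPos [Nonempty α] (S : ℕ → Prop) [DecidablePred S] (N n : ℕ)
    (h : n ≤ ((Finset.range N).filter S).card) :
    ∃ W : ParamWord α N n, ∀ {m : ℕ} (w : ParamWord α n (m + 1)), S (firstPos (subst id W w)) := by
  induction N generalizing n S with
  | zero =>
    obtain rfl : n = 0 := by simpa using h
    exact ⟨nil, fun w => by cases w⟩
  | succ N ih =>
    have hcard : ((Finset.range (N + 1)).filter S).card =
        ((Finset.range N).filter fun i => S (i + 1)).card + if S 0 then 1 else 0 := by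
      simp only [Finset.card_filter]
      rw [Finset.sum_range_succ']
    rw [hcard] at h
    have hcons : n ≤ ((Finset.range N).filter fun i => S (i + 1)).card →
        ∃ W : ParamWord α (N + 1) n,
          ∀ {m : ℕ} (w : ParamWord α n (m + 1)), S (firstPos (subst id W w)) := by
      intro h
      obtain ⟨W, hW⟩ := ih (fun i => S (i + 1)) n h
      obtain ⟨a⟩ := ‹Nonempty α›
      exact ⟨cons a W, fun w => hW w⟩
    by_cases h0 : S 0
    · cases n with
      | zero => exact hcons (Nat.zero_le _)
      | succ n =>
        obtain ⟨W, hW⟩ := ih (fun i => S (i + 1)) n (by simpa [h0] using h)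
        refine ⟨new (map some W), fun w => ?_⟩
        cases w with
        | cons a w =>
          have := hW w
          simp only [subst, firstPos, subst_map]
          exact this
        | new w => exact h0
    · exact hcons (by simpa [h0] using h)

/-- The case without parameters of the Graham–Rothschild theorem, that is, the multidimensional
Hales–Jewett theorem with parameters in the order of their first occurrences. -/
theorem graham_rothschild_zero (α : Type) [Finite α] [Nonempty α] (κ : Type 1) [Finite κ] (n : ℕ) :
    ∃ N, ∀ c : ParamWord α N 0 → κ, ∃ W : ParamWord α N n, ∃ k : κ,
      ∀ v : ParamWord α n 0, c (subst id W v) = k := by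
  induction n with
  | zero => exact ⟨0, fun c => ⟨nil, c nil, fun v => by cases v; rfl⟩⟩
  | succ n ih =>
    obtain ⟨n₂, h₂⟩ := ih
    obtain ⟨ι, _, hι⟩ :=
      Combinatorics.Line.exists_mono_in_high_dimension α (ParamWord α n₂ 0 → κ)
    refine ⟨n₂ + (Finset.univ : Finset ι).toList.length, fun c => ?_⟩
    obtain ⟨L, K, hL⟩ := hι fun u w => c (app u Finset.univ.toList w)
    obtain ⟨W, k, hW⟩ := h₂ K
    obtain ⟨P, -, hP⟩ := exists_lineApp L.idxFun (Finset.univ : Finset ι).toList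
      (by simpa using L.proper)
    refine ⟨P (map some W), k, fun v => ?_⟩
    cases v with
    | cons a v =>
      rw [hP, subst_map, ← hW v]
      exact congrFun (hL a) _

/-- The Graham–Rothschild theorem for `m` parameters and all alphabets yields the following for
`m + 1` parameters: after passing to a suitable word with `n` parameters, the colour of a word
depends only on the position at which its first parameter appears.

The proof is by induction on `n`. The word consists of a combinatorial line `L`, followed by `W₃`
with `W₄` substituted. The constants of `W₃` may be references to coordinates of `L`; these are the
letters from `ι`. By the choice of `W₃`, all words in which the first parameter appears at the
start have the same colour. By the choice of the line, the letter `a` put at the start otherwise does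
not affect the colour, and `W₄` comes from the induction hypothesis. -/
theorem exists_color_firstPos (m : ℕ)
    (gr : ∀ (α : Type) [Finite α] [Nonempty α] (κ : Type 1) [Finite κ] [Nonempty κ] (n : ℕ),
      ∃ N, ∀ c : ParamWord α N m → κ, ∃ W : ParamWord α N n, ∃ k : κ,
        ∀ v : ParamWord α n m, c (subst id W v) = k)
    (α : Type) [Finite α] [Nonempty α] (κ : Type 1) [Finite κ] [Nonempty κ] (n : ℕ) :
    ∃ N, ∀ c : ParamWord α N (m + 1) → κ, ∃ W : ParamWord α N n, ∃ g : ℕ → κ,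
      ∀ w : ParamWord α n (m + 1), c (subst id W w) = g (firstPos w) := by
  induction n with
  | zero =>
    exact ⟨0, fun c => ⟨nil, fun _ => Classical.arbitrary κ, fun w => by cases w⟩⟩
  | succ n ih =>
    obtain ⟨n₂, h₂⟩ := ih
    obtain ⟨ι, _, hι⟩ :=
      Combinatorics.Line.exists_mono_in_high_dimension α (ParamWord α n₂ (m + 1) → κ)
    obtain ⟨N, hN⟩ := gr (α ⊕ ι) ({l : ι → Option α // ∃ i, l i = none} → κ) n₂
    let e : List ι := (Finset.univ : Finset ι).toList
    have hprop : ∀ l : {l : ι → Option α // ∃ i, l i = none}, ∃ i ∈ e, l.1 i = none := by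
      intro l; simpa [e] using l.2
    choose P hPnew hPcons using
      fun l : {l : ι → Option α // ∃ i, l i = none} => exists_lineApp l.1 e (hprop l)
    refine ⟨N + e.length, fun c => ?_⟩
    obtain ⟨W₃, K, hK⟩ := hN fun v l => c (P l (map (Sum.elim some l.1) v))
    have hK' : ∀ (l) (v : ParamWord (Option α) n₂ m),
        c (P l (subst (Sum.elim some l.1) W₃ v)) = K l := by
      intro l v
      -- a moving coordinate of the line represents the letter `none`
      obtain ⟨i, hi⟩ := l.2
      have h := congrFun (hK (map (fun o => o.elim (Sum.inr i) Sum.inl) v)) l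
      rw [map_subst, map_map, map_id' (f := _ ∘ _)] at h
      · exact h
      · intro o; cases o <;> simp [hi]
    obtain ⟨L, C, hL⟩ := hι fun u w => c (app u e (subst (Sum.elim id u) W₃ w))
    obtain ⟨W₄, g, hg⟩ := h₂ C
    let l : {l : ι → Option α // ∃ i, l i = none} := ⟨L.idxFun, L.proper⟩
    refine ⟨P l (subst (Sum.elim some l.1) W₃ (map some W₄)),
      fun j => Nat.casesOn j (K l) g, fun w => ?_⟩
    cases w with
    | new w =>
      rw [hPnew, subst_subst]
      exact hK' l _
    | cons a w =>
      rw [hPcons, subst_subst, subst_map]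
      have h := congrFun (hL a) (subst id W₄ w)
      have h1 : ((fun o : Option α => o.getD a) ∘ Sum.elim some l.1) =
          Sum.elim id (fun i => (l.1 i).getD a) := by
        funext x; cases x <;> rfl
      rw [h1]
      simp only [firstPos]
      rw [← hg w, ← h]
      rfl

/-- The Graham–Rothschild theorem: for every finite colouring of the words with `m` parameters of
a suitable length, there is a word `W` with `n` parameters such that all substitutions of words with
`m` parameters into `W` have the same colour. -/
theorem graham_rothschild (m : ℕ) (α : Type) [Finite α] [Nonempty α] (κ : Type 1) [Finite κ]
    [Nonempty κ] (n : ℕ) :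
    ∃ N, ∀ c : ParamWord α N m → κ, ∃ W : ParamWord α N n, ∃ k : κ,
      ∀ v : ParamWord α n m, c (subst id W v) = k := by
  induction m generalizing α κ n with
  | zero => exact graham_rothschild_zero α κ n
  | succ m ih =>
    classical
    have := Fintype.ofFinite κ
    obtain ⟨N, hN⟩ := exists_color_firstPos m ih α κ (Fintype.card κ * n)
    refine ⟨N, fun c => ?_⟩
    obtain ⟨W, g, hg⟩ := hN c
    obtain ⟨k, -, hk⟩ := Finset.exists_le_card_fiber_of_mul_le_card_of_maps_to
      (s := Finset.range (Fintype.card κ * n)) (t := (Finset.univ : Finset κ)) (f := g) (n := n)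
      (fun _ _ => Finset.mem_univ _) Finset.univ_nonempty (by simp)
    obtain ⟨V, hV⟩ := exists_subst_firstPos (α := α) (fun i => g i = k) _ n hk
    refine ⟨subst id W V, k, fun v => ?_⟩
    rw [subst_subst]
    exact (hg _).trans (hV v)

end ParamWord
end Semigeneric

/-! ### The action of parameter words on lists -/

namespace Semigeneric
namespace ParamWord

variable {α β γ : Type} {N n m k : ℕ}

/-- Substitution of the entries of a list of length `m` for the parameters of a word with `m`
parameters, with `f` applied to the letters of the word. On lists shorter than `m` the value is
truncated; superfluous entries are ignored. -/
def act : {α β : Type} → {n m : ℕ} → (α → β) → ParamWord α n m → List β → List β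
  | _, _, _, _, _, nil, _ => []
  | _, _, _, _, f, cons a w, l => f a :: act f w l
  | _, _, _, _, f, new w, b :: l => b :: act (fun o => o.elim b f) w l
  | _, _, _, _, _, new _, [] => []

theorem map_act (f : α → β) (g : β → γ) (w : ParamWord α n m) (l : List β) :
    (act f w l).map g = act (g ∘ f) w (l.map g) := by
  induction w generalizing β γ l with
  | nil => rfl
  | cons a w ih => simp [act, ih]
  | new w ih =>
    cases l with
    | nil => rfl
    | cons b l =>
      simp only [act, List.map_cons, ih]
      congr 2
      funext o; cases o <;> rfl

theorem act_subst (g : α → β) (f : β → γ) (w : ParamWord α N n) (v : ParamWord β n m)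
    (l : List γ) : act f (subst g w v) l = act (f ∘ g) w (act f v l) := by
  induction w generalizing β γ m l with
  | nil => cases v; rfl
  | cons a w ih => simp [act, subst, ih]
  | new w ih =>
    cases v with
    | cons b v =>
      simp only [act, subst, ih]
      congr 2
      funext o; cases o <;> rfl
    | new v =>
      cases l with
      | nil => rfl
      | cons c l =>
        simp only [act, subst, ih]
        congr 2
        funext o; cases o <;> rfl

theorem length_act (f : α → β) (w : ParamWord α n m) {l : List β} (hl : l.length = m) :
    (act f w l).length = n := by
  induction w generalizing β l with
  | nil => rfl
  | cons a w ih => simp [act, ih f hl]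
  | new w ih =>
    cases l with
    | nil => simp at hl
    | cons b l => simp [act, ih _ (Nat.succ.inj hl)]

theorem act_injective (f : α → β) (w : ParamWord α n m) {l l' : List β} (hl : l.length = m)
    (hl' : l'.length = m) : act f w l = act f w l' ↔ l = l' := by
  induction w generalizing β l l' with
  | nil =>
    rw [List.length_eq_zero_iff] at hl hl'
    simp [hl, hl']
  | cons a w ih => simp [act, ih f hl hl']
  | new w ih =>
    cases l with
    | nil => simp at hl
    | cons b l =>
      cases l' with
      | nil => simp at hl'
      | cons b' l' =>
        simp only [act, List.cons.injEq]
        refine and_congr_right ?_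
        rintro rfl
        exact ih _ (Nat.succ.inj hl) (Nat.succ.inj hl')

theorem act_lt_act [LinearOrder β] (f : α → β) (w : ParamWord α n m) {l l' : List β}
    (hl : l.length = m) (hl' : l'.length = m) : act f w l < act f w l' ↔ l < l' := by
  induction w generalizing l l' with
  | nil =>
    rw [List.length_eq_zero_iff] at hl hl'
    simp [hl, hl', act]
  | cons a w ih => simp [act, ih f hl hl']
  | new w ih =>
    cases l with
    | nil => simp at hl
    | cons b l =>
      cases l' with
      | nil => simp at hl'
      | cons b' l' =>
        simp only [act, List.cons_lt_cons_iff]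
        refine or_congr_right (and_congr_right ?_)
        rintro rfl
        exact ih _ (Nat.succ.inj hl) (Nat.succ.inj hl')

theorem zip_act (f : α → β) (g : α → γ) (w : ParamWord α n m) {l : List β} {l' : List γ}
    (hl : l.length = m) (hl' : l'.length = m) :
    (act f w l).zip (act g w l') = act (fun a => (f a, g a)) w (l.zip l') := by
  induction w generalizing β γ l l' with
  | nil => rfl
  | cons a w ih => simp [act, ih f g hl hl']
  | new w ih =>
    cases l with
    | nil => simp at hl
    | cons b l =>
      cases l' with
      | nil => simp at hl'
      | cons b' l' =>
        simp only [act, List.zip_cons_cons, ih _ _ (Nat.succ.inj hl) (Nat.succ.inj hl')]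
        congr 2
        funext o; cases o <;> rfl

theorem mem_act (f : α → β) (w : ParamWord α n m) {l : List β} (hl : l.length = m) {b : β}
    (hb : ∀ a, f a ≠ b) : b ∈ act f w l ↔ b ∈ l := by
  induction w generalizing l with
  | nil =>
    rw [List.length_eq_zero_iff] at hl
    simp [act, hl]
  | cons a w ih => simp [act, (hb a).symm, ih f hl hb]
  | new w ih =>
    cases l with
    | nil => simp at hl
    | cons c l =>
      simp only [act, List.mem_cons]
      by_cases hc : b = c
      · simp [hc]
      · rw [ih _ (Nat.succ.inj hl)]
        intro o
        cases o with
        | none => exact fun h => hc h.symm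
        | some a => exact hb a

/-- If the entries of the list `l`, apart from those in the range of `f`, have their first
occurrences in increasing order, then `l` arises from the sorted list of these entries by the action
of a parameter word. -/
theorem exists_act_eq {δ : Type} [LinearOrder δ] (key : β → δ) (hkey : Function.Injective key)
    (f : α → β) (l : List β)
    (hl : ∀ l₁ x l₂, l = l₁ ++ x :: l₂ → ∀ y ∈ l₂, key y < key x → y ∈ l₁ ∨ y ∈ Set.range f) :
    ∃ (m : ℕ) (w : ParamWord α l.length m) (l' : List β), l'.length = m ∧ act f w l' = l ∧
      l'.Pairwise (fun x y => key x < key y) ∧ ∀ y, y ∈ l' ↔ y ∈ l ∧ y ∉ Set.range f := by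
  induction l generalizing α with
  | nil => exact ⟨0, nil, [], rfl, rfl, List.Pairwise.nil, by simp⟩
  | cons x l ih =>
    by_cases hx : x ∈ Set.range f
    · obtain ⟨a, rfl⟩ := hx
      obtain ⟨m, w, l', hm, hw, hp, hmem⟩ := ih f (by
        rintro l₁ z l₂ rfl y hy hyz
        have := hl (f a :: l₁) z l₂ rfl y hy hyz
        simp only [List.mem_cons, Set.mem_range] at this ⊢
        rcases this with (rfl | h) | h
        · exact Or.inr ⟨a, rfl⟩
        · exact Or.inl h
        · exact Or.inr h)
      refine ⟨m, cons a w, l', hm, by simp [act, hw], hp, fun y => ?_⟩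
      rw [hmem, List.mem_cons]
      constructor
      · exact fun h => ⟨Or.inr h.1, h.2⟩
      · rintro ⟨rfl | h, h'⟩
        · exact absurd ⟨a, rfl⟩ h'
        · exact ⟨h, h'⟩
    · have hrange : ∀ y, y ∈ Set.range (fun o : Option α => o.elim x f) ↔
          y = x ∨ y ∈ Set.range f := by
        intro y
        constructor
        · rintro ⟨o, rfl⟩
          cases o with
          | none => exact Or.inl rfl
          | some a => exact Or.inr ⟨a, rfl⟩
        · rintro (rfl | ⟨a, rfl⟩)
          · exact ⟨none, rfl⟩
          · exact ⟨some a, rfl⟩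
      obtain ⟨m, w, l', hm, hw, hp, hmem⟩ := ih (fun o : Option α => o.elim x f) (by
        rintro l₁ z l₂ rfl y hy hyz
        have := hl (x :: l₁) z l₂ rfl y hy hyz
        rw [hrange]
        simp only [List.mem_cons] at this
        tauto)
      refine ⟨m + 1, new w, x :: l', by simp [hm], by simp [act, hw], ?_, fun y => ?_⟩
      · rw [List.pairwise_cons]
        refine ⟨fun y hy => ?_, hp⟩
        have h1 := (hmem y).1 hy
        rw [hrange, not_or] at h1
        refine lt_of_le_of_ne (le_of_not_gt fun hlt => ?_) fun he => h1.2.1 (hkey he).symm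
        rcases hl [] x l rfl y h1.1 hlt with h | h
        · simp at h
        · exact h1.2.2 h
      · rw [List.mem_cons, List.mem_cons, hmem, hrange, not_or]
        constructor
        · rintro (rfl | h)
          · exact ⟨Or.inl rfl, hx⟩
          · exact ⟨Or.inr h.1, h.2.2⟩
        · rintro ⟨h1, h2⟩
          by_cases hy : y = x
          · exact Or.inl hy
          · exact Or.inr ⟨h1.resolve_left hy, hy, h2⟩

end ParamWord
end Semigeneric

namespace Semigeneric

/-! ### Axioms for the members of the age -/

section Axioms

variable {V W : Type}

/-- Universal axioms for the expanded graphs: `lt` is a convex linear order, `R x u` holds only for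
points in different parts and depends on `x` only through its part, and the edges are determined by
`R` and `lt`. -/
structure IsStarModel (G : Digraph V) (R lt : V → V → Prop) : Prop where
  nonEdge_equiv : Equivalence (NonEdge G)
  order : IsConvexLinearOrder G lt
  not_nonEdge_of_sub : ∀ x u, R x u → ¬ NonEdge G x u
  sub_congr : ∀ x x' u, NonEdge G x x' → R x u → R x' u
  adj_iff : ∀ x y, G.Adj x y ↔ ¬ NonEdge G x y ∧ (lt x y ↔ ¬ (R x y ↔ R y x))

/-- In a convex linear order, the order of points in different parts depends only on the parts. -/
theorem IsConvexLinearOrder.lt_of_lt {G : Digraph V} {lt : V → V → Prop}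
    (h : IsConvexLinearOrder G lt) (hG : Equivalence (NonEdge G)) {a a' b b' : V}
    (ha : NonEdge G a a') (hb : NonEdge G b b') (hab : ¬ NonEdge G a b) (hlt : lt a b) :
    lt a' b' := by
  have h1 : lt a b' := by
    rcases h.total a b' with h1 | rfl | h1
    · exact h1
    · exact absurd (hG.symm hb) hab
    · exact absurd (hG.trans (hG.symm (h.convex _ _ _ h1 hlt (hG.symm hb))) (hG.symm hb)) hab
  rcases h.total a' b' with h2 | rfl | h2
  · exact h2
  · exact absurd (hG.trans ha (hG.symm hb)) hab
  · exact absurd (hG.trans (h.convex _ _ _ h1 h2 ha) (hG.symm hb)) hab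

theorem even_ncard_edges_iff (G : Digraph V) {u v x y : V} (huv : u ≠ v) (hxy : x ≠ y) :
    Even (Set.ncard {e : V × V | (e.1 = u ∨ e.1 = v) ∧ (e.2 = x ∨ e.2 = y) ∧ G.Adj e.1 e.2}) ↔
      ((G.Adj u x ↔ G.Adj u y) ↔ (G.Adj v x ↔ G.Adj v y)) := by
  classical
  have h : {e : V × V | (e.1 = u ∨ e.1 = v) ∧ (e.2 = x ∨ e.2 = y) ∧ G.Adj e.1 e.2} =
      ↑((({u, v} : Finset V) ×ˢ ({x, y} : Finset V)).filter fun e => G.Adj e.1 e.2) := by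
    ext e
    simp [and_assoc]
  rw [h, Set.ncard_coe_finset, Finset.card_filter, Finset.sum_product, Finset.sum_pair huv,
    Finset.sum_pair hxy, Finset.sum_pair hxy]
  by_cases h1 : G.Adj u x <;> by_cases h2 : G.Adj u y <;> by_cases h3 : G.Adj v x <;>
    by_cases h4 : G.Adj v y <;> simp [h1, h2, h3, h4] <;> decide

/-- The edges of an admissible expansion are determined by `R` and the order: for `x < y` in the
parts of `t_i` and `t_j`, apply the parity constraint to the pairs `{t_i, x}` and `{t_j, y}`. -/
theorem IsExpansion.isStarModel {G : Digraph V} {R lt : V → V → Prop} {k : ℕ}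
    (h : IsExpansion G R lt k) : IsStarModel G R lt := by
  obtain ⟨hG, -, H, ltH, hH, ⟨part, hpart, hNE⟩, hHG, hHt, hR, hord, hordt, hlt⟩ := h
  have hne : ∀ x y, NonEdge H (Sum.inl x) (Sum.inl y) ↔ NonEdge G x y := by
    intro x y; simp [NonEdge, hHG]
  have htt : ∀ i j, NonEdge H (Sum.inr i) (Sum.inr j) → i = j := by
    intro i j hij
    simp only [NonEdge, hHt, not_lt] at hij
    exact le_antisymm hij.2 hij.1
  -- the transversal meets every part
  have hex : ∀ x : V, ∃ i, NonEdge H (Sum.inr i) (Sum.inl x) := by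
    intro x
    have hinj : Function.Injective fun i : Fin k => part (Sum.inr i) :=
      fun i j hij => htt i j ((hNE _ _).2 hij)
    obtain ⟨i, hi⟩ := Finite.surjective_of_injective hinj (part (Sum.inl x))
    exact ⟨i, (hNE _ _).2 hi⟩
  have heq := hH.multipartite.equiv
  have hR' : ∀ x u i, NonEdge H (Sum.inr i) (Sum.inl x) →
      (R x u ↔ ¬ NonEdge G x u ∧ H.Adj (Sum.inr i) (Sum.inl u)) := by
    intro x u i hi
    rw [hR]
    refine and_congr_right fun _ => ⟨?_, fun h => ⟨i, hi, h⟩⟩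
    rintro ⟨j, hj, h⟩
    rwa [htt i j (heq.trans hi (heq.symm hj))]
  have hflip : ∀ a b, ¬ NonEdge H a b → (H.Adj b a ↔ ¬ H.Adj a b) := by
    intro a b hab
    refine ⟨fun h => hH.multipartite.asymm _ _ h, fun h => ?_⟩
    by_contra h'
    exact hab ⟨h, h'⟩
  have hordG : IsConvexLinearOrder G lt := by
    refine ⟨fun x => ?_, fun x y z => ?_, fun x y => ?_, fun x y z => ?_⟩
    · rw [hlt]; exact hord.irrefl _
    · simp only [hlt]; exact hord.trans _ _ _
    · simp only [hlt]
      rcases hord.total (Sum.inl x) (Sum.inl y) with h | h | h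
      · exact Or.inl h
      · exact Or.inr (Or.inl (Sum.inl_injective h))
      · exact Or.inr (Or.inr h)
    · simp only [hlt, ← hne]; exact hord.convex _ _ _
  -- edges between two parts in increasing order
  have hadj : ∀ x y, ¬ NonEdge G x y → lt x y → (G.Adj x y ↔ ¬ (R x y ↔ R y x)) := by
    intro x y hxy hltxy
    obtain ⟨i, hi⟩ := hex x
    obtain ⟨j, hj⟩ := hex y
    have hxy' : ¬ NonEdge H (Sum.inl x) (Sum.inl y) := by rwa [hne]
    have hyx : ¬ NonEdge G y x := fun h => hxy (hG.multipartite.equiv.symm h)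
    have hij : i < j := by
      have h1 := hord.lt_of_lt heq (heq.symm hi) (heq.symm hj) hxy' ((hlt _ _).1 hltxy)
      rcases lt_trichotomy i j with h | rfl | h
      · exact h
      · exact absurd h1 (hord.irrefl _)
      · exact absurd (hord.trans _ _ _ h1 (hordt _ _ h)) (hord.irrefl _)
    have hpar := (even_ncard_edges_iff H (u := Sum.inr i) (v := Sum.inl x) (x := Sum.inr j)
      (y := Sum.inl y) (by simp) (by simp)).1
        (hH.parity _ _ _ _ (by simp) (by simp) hi hj fun h =>
          absurd (htt i j h) hij.ne)
    have hxj : ¬ NonEdge H (Sum.inl x) (Sum.inr j) := fun h => hxy' (heq.trans h hj)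
    rw [hR' x y i hi, hR' y x j hj, hflip _ _ hxj, ← hHG]
    have := (hHt i j).2 hij
    tauto
  refine ⟨hG.multipartite.equiv, hordG, fun x u hx => ((hR x u).1 hx).1, ?_, ?_⟩
  · intro x x' u hxx' hx
    obtain ⟨i, hi⟩ := hex x
    rw [hR' x u i hi] at hx
    rw [hR' x' u i (heq.trans hi ((hne _ _).2 hxx'))]
    exact ⟨fun h => hx.1 (hG.multipartite.equiv.trans hxx' h), hx.2⟩
  · intro x y
    by_cases hxy : NonEdge G x y
    · simp [hxy, hxy.1]
    · simp only [hxy, not_false_eq_true, true_and]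
      have hyx : ¬ NonEdge G y x := fun h => hxy (hG.multipartite.equiv.symm h)
      rcases hordG.total x y with h | rfl | h
      · simp [h, hadj x y hxy h]
      · exact absurd (hG.multipartite.equiv.refl x) hxy
      · have h' : ¬ lt x y := fun h' => hordG.irrefl _ (hordG.trans _ _ _ h h')
        have h2 := hadj y x hyx h
        have h3 : G.Adj x y ↔ ¬ G.Adj y x := by
          rw [← hHG, ← hHG]
          exact hflip _ _ (by rwa [hne])
        rw [h3, h2]
        tauto

theorem IsStarModel.comap {G : Digraph V} {R lt : V → V → Prop} (h : IsStarModel G R lt)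
    (f : W → V) (hf : Function.Injective f) {G' : Digraph W} {R' lt' : W → W → Prop}
    (hG : ∀ x y, G'.Adj x y ↔ G.Adj (f x) (f y)) (hR : ∀ x y, R' x y ↔ R (f x) (f y))
    (hlt : ∀ x y, lt' x y ↔ lt (f x) (f y)) : IsStarModel G' R' lt' := by
  have hne : ∀ x y, NonEdge G' x y ↔ NonEdge G (f x) (f y) := by
    intro x y; simp [NonEdge, hG]
  refine ⟨⟨fun x => ?_, fun {x y} => ?_, fun {x y z} => ?_⟩, ⟨fun x => ?_, fun x y z => ?_,
    fun x y => ?_, fun x y z => ?_⟩, fun x u => ?_, fun x x' u => ?_, fun x y => ?_⟩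
  · rw [hne]; exact h.nonEdge_equiv.refl _
  · simp only [hne]; exact h.nonEdge_equiv.symm
  · simp only [hne]; exact h.nonEdge_equiv.trans
  · rw [hlt]; exact h.order.irrefl _
  · simp only [hlt]; exact h.order.trans _ _ _
  · simp only [hlt, ← hf.eq_iff]; exact h.order.total _ _
  · simp only [hlt, hne]; exact h.order.convex _ _ _
  · simp only [hR, hne]; exact h.not_nonEdge_of_sub _ _
  · simp only [hR, hne]; exact h.sub_congr _ _ _
  · simp only [hR, hne, hG, hlt]; exact h.adj_iff _ _

end Axioms

/-! ### Graphs given by labels -/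

section LabelGraph

variable {V Q : Type} [LinearOrder Q]

/-- The graph whose parts are the fibres of `q`, and in which the direction of the edge between
`x` and `y` is determined by the label `F (q x) y` that `y` carries for the part of `x` and by the
label `F (q y) x`. -/
def labelGraph (q : V → Q) (F : Q → V → Prop) : Digraph V where
  Adj x y := q x ≠ q y ∧ (q x < q y ↔ ¬ (F (q x) y ↔ F (q y) x))

theorem nonEdge_labelGraph {q : V → Q} {F : Q → V → Prop} {x y : V} :
    NonEdge (labelGraph q F) x y ↔ q x = q y := by
  simp only [NonEdge, labelGraph]
  rcases lt_trichotomy (q x) (q y) with h | h | h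
  · have := h.ne; have := h.ne'; have := h.not_gt; tauto
  · simp [h]
  · have := h.ne; have := h.ne'; have := h.not_gt; tauto

theorem inS_labelGraph [Finite V] (q : V → Q) (F : Q → V → Prop) : InS (labelGraph q F) := by
  refine ⟨inferInstance, ⟨?_, ?_⟩, ?_⟩
  · intro x y
    simp only [labelGraph]
    rintro ⟨h1, h2⟩ ⟨-, h3⟩
    rcases lt_or_gt_of_ne h1 with h | h <;> have := h.not_gt <;> tauto
  · simp only [funext₂ fun x y => propext (nonEdge_labelGraph (q := q) (F := F) (x := x) (y := y))]
    exact ⟨fun _ => rfl, Eq.symm, Eq.trans⟩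
  · intro u v x y huv hxy h1 h2 h3
    rw [nonEdge_labelGraph] at h1 h2 h3
    rw [even_ncard_edges_iff _ huv hxy]
    simp only [labelGraph]
    rw [← h1, ← h2]
    generalize F (q u) x = a, F (q u) y = b, F (q x) u = c, F (q x) v = d
    simp only [ne_eq, h3, not_false_eq_true, true_and]
    generalize (q u < q x) = e
    clear * -
    grind

/-- Any assignment of labels yields an admissible expansion. The required transversal consists of
new points `t_j`, added to the parts as their last points, with the label `i < j` for the part of
index `i`. -/
theorem isExpansion_labelGraph [Finite V] [LinearOrder V] (q : V → Q) (hq : Monotone q)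
    (F : Q → V → Prop) :
    ∃ k, IsExpansion (labelGraph q F) (fun x u => q x ≠ q u ∧ F (q x) u) (· < ·) k := by
  classical
  have := Fintype.ofFinite V
  let s : Finset Q := Finset.univ.image q
  let e : Fin s.card ≃o s := s.orderIsoOfFin rfl
  have hmem : ∀ x, q x ∈ s := fun x => Finset.mem_image_of_mem _ (Finset.mem_univ x)
  let p : V → Fin s.card := fun x => e.symm ⟨q x, hmem x⟩
  have hep : ∀ x, (e (p x) : Q) = q x := by intro x; simp [p]
  have hpeq : ∀ x y, p x = p y ↔ q x = q y := by intro x y; simp [p]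
  have hplt : ∀ x y, p x < p y ↔ q x < q y := by intro x y; simp [p]
  have hpsurj : Function.Surjective p := by
    intro i
    obtain ⟨x, -, hx⟩ := Finset.mem_image.1 (e i).2
    exact ⟨x, e.injective (Subtype.ext (by rw [hep, hx]))⟩
  let p' : V ⊕ Fin s.card → Fin s.card := Sum.elim p id
  -- the label of the point `t_j` of the transversal is `{i | i < j}`
  let F' : Fin s.card → V ⊕ Fin s.card → Prop :=
    fun i => Sum.elim (fun x => F (e i) x) (fun j => i < j)
  let pos : V ⊕ Fin s.card → Fin s.card ×ₗ (V ⊕ₗ Fin s.card) := fun a => toLex (p' a, toLex a)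
  have hpos : Function.Injective pos := by
    intro a b hab
    simpa [pos] using congrArg (fun z => ofLex (ofLex z).2) hab
  refine ⟨s.card, inS_labelGraph q F, ⟨p, hpsurj, fun x y => ?_⟩, labelGraph p' F',
    fun a b => pos a < pos b, inS_labelGraph _ _, ⟨p', fun i => ⟨Sum.inr i, rfl⟩, fun a b =>
      nonEdge_labelGraph⟩, fun x y => ?_, fun i j => ?_, fun x u => ?_,
    ⟨fun a => lt_irrefl _, fun a b c => lt_trans, fun a b => ?_, fun a b c hab hbc hac => ?_⟩,
    fun i j hij => ?_, fun x y => ?_⟩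
  · rw [nonEdge_labelGraph, hpeq]
  · simp [labelGraph, p', F', hpeq, hplt, hep]
  · simp only [labelGraph, p', F', Sum.elim_inr, id]
    rcases lt_trichotomy i j with h | h | h
    · simp [h, h.ne, h.not_gt]
    · simp [h]
    · simp [h, h.ne', h.not_gt]
  · rw [nonEdge_labelGraph]
    refine and_congr_right fun hxu => ?_
    rw [ne_eq, ← hpeq] at hxu
    have hex : (∃ i, NonEdge (labelGraph p' F') (Sum.inr i) (Sum.inl x) ∧
        (labelGraph p' F').Adj (Sum.inr i) (Sum.inl u)) ↔
        (labelGraph p' F').Adj (Sum.inr (p x)) (Sum.inl u) := by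
      constructor
      · rintro ⟨i, hi, h⟩
        obtain rfl : i = p x := nonEdge_labelGraph.1 hi
        exact h
      · exact fun h => ⟨p x, nonEdge_labelGraph.2 rfl, h⟩
    rw [hex]
    simp only [p', Sum.elim_inr, Sum.elim_inl, id, labelGraph, F', hep]
    rcases lt_or_gt_of_ne hxu with h | h
    · simp [h, hxu, h.not_gt]
    · simp [h, hxu, h.not_gt]
  · rcases lt_trichotomy (pos a) (pos b) with h | h | h
    · exact Or.inl h
    · exact Or.inr (Or.inl (hpos h))
    · exact Or.inr (Or.inr h)
  · rw [nonEdge_labelGraph] at hac ⊢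
    have h1 : p' a ≤ p' b := (Prod.Lex.toLex_lt_toLex'.1 hab).1
    have h2 : p' b ≤ p' c := (Prod.Lex.toLex_lt_toLex'.1 hbc).1
    exact le_antisymm h1 (hac ▸ h2)
  · exact Prod.Lex.toLex_lt_toLex.2 (Or.inl hij)
  · simp only [pos, Prod.Lex.toLex_lt_toLex, p', Sum.elim_inl, hplt, hpeq, Sum.Lex.inl_lt_inl_iff]
    constructor
    · intro h
      rcases (hq h.le).lt_or_eq with h' | h'
      · exact Or.inl h'
      · exact Or.inr ⟨h', h⟩
    · rintro (h | h)
      · by_contra h'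
        exact absurd (hq (not_lt.1 h')) h.not_ge
      · exact h.2

end LabelGraph

end Semigeneric

namespace Semigeneric

/-! ### The structure on the set of words -/

section Words

/-- The words of length `N` over three letters. The positions of the letter `0` in a word determine
the part of the word; the letter `1` serves to define labels; the letter `2` is neutral. -/
def Word (N : ℕ) : Type := {l : List (Fin 3) // l.length = N}

variable {N n m : ℕ}

instance : Finite (Word N) := inferInstanceAs (Finite (List.Vector (Fin 3) N))

/-- The part of a word: `false` marks the positions of the letter `0`. -/
def partKey (l : List (Fin 3)) : List Bool := l.map fun s => decide (s ≠ 0)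

/-- The label that the word `u` carries for the part `j`: at some position the part has its mark
`false`, while `u` has the letter `1`. -/
def HasLabel (j : List Bool) (u : List (Fin 3)) : Prop := (false, (1 : Fin 3)) ∈ j.zip u

/-- Words are compared lexicographically, first by their parts and then by their letters. -/
noncomputable instance : LinearOrder (Word N) :=
  LinearOrder.lift' (fun w => (toLex (partKey w.1, w.1) : List Bool ×ₗ List (Fin 3)))
    fun _ _ h => Subtype.ext (congrArg (fun z => (ofLex z).2) h)

theorem Word.lt_iff {x y : Word N} :
    x < y ↔ partKey x.1 < partKey y.1 ∨ partKey x.1 = partKey y.1 ∧ x.1 < y.1 :=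
  Prod.Lex.toLex_lt_toLex (x := (partKey x.1, x.1)) (y := (partKey y.1, y.1))

theorem partKey_mono : Monotone fun w : Word N => partKey w.1 := by
  intro x y h
  rcases h.lt_or_eq with h | rfl
  · rcases Word.lt_iff.1 h with h | h
    · exact h.le
    · exact h.1.le
  · exact le_rfl

/-- The edges on the set of words. -/
def wordGraph (N : ℕ) : Digraph (Word N) :=
  labelGraph (fun w => partKey w.1) fun j w => HasLabel j w.1

/-- The relation `R` on the set of words. -/
def wordSub (x u : Word N) : Prop := partKey x.1 ≠ partKey u.1 ∧ HasLabel (partKey x.1) u.1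

noncomputable instance : starLang.Structure (Word N) where
  funMap := fun f => nomatch f
  RelMap := fun r => match r with
    | StarRel.edge => fun v => (wordGraph N).Adj (v 0) (v 1)
    | StarRel.sub => fun v => wordSub (v 0) (v 1)
    | StarRel.lt => fun v => v 0 < v 1

theorem exists_isExpansion_word (N : ℕ) :
    ∃ k, IsExpansion (edgeGraph (Word N)) (subRel (Word N)) (ltRel (Word N)) k :=
  isExpansion_labelGraph (fun w : Word N => partKey w.1) partKey_mono fun j w => HasLabel j w.1

theorem isStarModel_word (N : ℕ) :
    IsStarModel (edgeGraph (Word N)) (subRel (Word N)) (ltRel (Word N)) :=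
  (exists_isExpansion_word N).elim fun _ h => h.isStarModel

theorem nonEdge_word {x y : Word N} :
    NonEdge (edgeGraph (Word N)) x y ↔ partKey x.1 = partKey y.1 :=
  nonEdge_labelGraph (q := fun w : Word N => partKey w.1) (F := fun j w => HasLabel j w.1)

/-- Substitution of the letters of a word for the parameters of a parameter word. -/
def actWord (W : ParamWord (Fin 3) N m) (x : Word m) : Word N :=
  ⟨W.act id x.1, W.length_act id x.2⟩

theorem partKey_act (W : ParamWord (Fin 3) N m) (l : List (Fin 3)) :
    partKey (W.act id l) = W.act (fun s => decide (s ≠ 0)) (partKey l) :=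
  ParamWord.map_act _ _ _ _

theorem length_partKey (l : List (Fin 3)) : (partKey l).length = l.length := List.length_map _

theorem partKey_actWord_eq (W : ParamWord (Fin 3) N m) (x y : Word m) :
    partKey (actWord W x).1 = partKey (actWord W y).1 ↔ partKey x.1 = partKey y.1 := by
  simp only [actWord, partKey_act]
  exact W.act_injective _ ((length_partKey _).trans x.2) ((length_partKey _).trans y.2)

theorem actWord_lt (W : ParamWord (Fin 3) N m) (x y : Word m) :
    actWord W x < actWord W y ↔ x < y := by
  rw [Word.lt_iff, Word.lt_iff, partKey_actWord_eq]
  simp only [actWord, partKey_act]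
  rw [W.act_lt_act _ ((length_partKey _).trans x.2) ((length_partKey _).trans y.2),
    W.act_lt_act _ x.2 y.2]

/-- Substitution preserves `R`: at the position of a constant `s`, the part of the first word has
its mark only for `s = 0`, and then the second word has the letter `0`, not `1`. -/
theorem wordSub_actWord (W : ParamWord (Fin 3) N m) (x y : Word m) :
    wordSub (actWord W x) (actWord W y) ↔ wordSub x y := by
  rw [wordSub, wordSub, ne_eq, partKey_actWord_eq]
  refine and_congr_right fun _ => ?_
  simp only [actWord, partKey_act, HasLabel]
  rw [W.zip_act _ _ ((length_partKey _).trans x.2) y.2, ParamWord.mem_act]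
  · rw [List.length_zip, length_partKey, x.2, y.2, min_self]
  · decide

end Words

/-! ### Embeddings -/

section Embeddings

variable {A C : Type} [starLang.Structure A] [starLang.Structure C]

/-- A map that preserves and reflects parts, `R` and the order is an embedding, since these
determine the edges. -/
def starEmbedding (hA : IsStarModel (edgeGraph A) (subRel A) (ltRel A))
    (hC : IsStarModel (edgeGraph C) (subRel C) (ltRel C)) (f : A → C)
    (hne : ∀ x y, NonEdge (edgeGraph C) (f x) (f y) ↔ NonEdge (edgeGraph A) x y)
    (hR : ∀ x y, subRel C (f x) (f y) ↔ subRel A x y)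
    (hlt : ∀ x y, ltRel C (f x) (f y) ↔ ltRel A x y) : A ↪[starLang] C where
  toFun := f
  inj' := by
    intro x y hxy
    rcases hA.order.total x y with h | h | h
    · exact absurd (hxy ▸ (hlt _ _).2 h) (hC.order.irrefl _)
    · exact h
    · exact absurd (hxy ▸ (hlt _ _).2 h) (hC.order.irrefl _)
  map_fun' := fun f => nomatch f
  map_rel' := by
    have hpair : ∀ v : Fin 2 → A, ∃ a b, v = ![a, b] ∧ f ∘ v = ![f a, f b] := fun v =>
      ⟨v 0, v 1, by funext i; fin_cases i <;> rfl, by funext i; fin_cases i <;> rfl⟩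
    intro n r v
    cases r with
    | edge =>
      obtain ⟨a, b, rfl, h⟩ := hpair v
      rw [h]
      have h1 := hC.adj_iff (f a) (f b)
      rw [hne, hlt, hR, hR, ← hA.adj_iff] at h1
      exact h1
    | sub =>
      obtain ⟨a, b, rfl, h⟩ := hpair v
      rw [h]
      exact hR a b
    | lt =>
      obtain ⟨a, b, rfl, h⟩ := hpair v
      rw [h]
      exact hlt a b

theorem rel_iff_of_embedding (f : A ↪[starLang] C) (r : starLang.Relations 2) (x y : A) :
    FirstOrder.Language.Structure.RelMap r ![x, y] ↔
      FirstOrder.Language.Structure.RelMap r ![f x, f y] := by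
  rw [← f.map_rel]
  have : (f ∘ ![x, y] : Fin 2 → C) = ![f x, f y] := by
    funext i; fin_cases i <;> rfl
  rw [this]

end Embeddings

end Semigeneric

namespace Semigeneric

/-! ### Good letter assignments and their order -/

section Letters

variable {A : Type}

/-- The letter assignments that may occur at a position of a representation by words: the letter `0`
is used on a union of parts, and a point `x` with letter `0` and a point `u` with letter `1`, which
enforce `R x u` in the structure of words, do satisfy `R x u`. -/
structure IsGood (G : Digraph A) (R : A → A → Prop) (g : A → Fin 3) : Prop where
  closed : ∀ x y, NonEdge G x y → g x = 0 → g y = 0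
  sub : ∀ x u, g x = 0 → g u = 1 → R x u

theorem fin_three_cases (s : Fin 3) : s = 0 ∨ s = 1 ∨ s = 2 := by
  fin_cases s <;> simp

variable [Fintype A]

/-- The order in which letter assignments are listed: the sets of points with letter `0` are
compared in the colexicographic order, and then the sets of points with letter `1`. -/
def letterKey (g : A → Fin 3) : Colex (Finset A) ×ₗ Colex (Finset A) :=
  toLex (toColex (Finset.univ.filter fun a => g a = 0),
    toColex (Finset.univ.filter fun a => g a = 1))

theorem letterKey_injective : Function.Injective (letterKey (A := A)) := by
  intro g h hgh
  have h0 := congrArg (fun z => ofColex (ofLex z).1) hgh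
  have h1 := congrArg (fun z => ofColex (ofLex z).2) hgh
  simp only [letterKey, ofLex_toLex, ofColex_toColex, Finset.mem_univ,
    Finset.ext_iff, Finset.mem_filter, true_and] at h0 h1
  funext a
  have h0 := h0 a
  have h1 := h1 a
  rcases fin_three_cases (g a) with h2 | h2 | h2 <;>
    rcases fin_three_cases (h a) with h3 | h3 | h3 <;> simp_all

variable [LinearOrder A]

theorem letterKey_lt {g h : A → Fin 3} : letterKey g < letterKey h ↔
    (∃ a, h a = 0 ∧ g a ≠ 0 ∧ ∀ b, g b = 0 → h b ≠ 0 → b < a) ∨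
    (∀ a, g a = 0 ↔ h a = 0) ∧ ∃ a, h a = 1 ∧ g a ≠ 1 ∧ ∀ b, g b = 1 → h b ≠ 1 → b < a := by
  simp only [letterKey, Prod.Lex.toLex_lt_toLex, toColex_inj,
    Finset.Colex.toColex_lt_toColex_iff_exists_forall_lt, Finset.ext_iff, Finset.mem_filter,
    Finset.mem_univ, true_and]

theorem exists_list_isGood (G : Digraph A) (R : A → A → Prop) :
    ∃ l : List (A → Fin 3), l.Pairwise (fun g h => letterKey g < letterKey h) ∧
      ∀ g, g ∈ l ↔ IsGood G R g ∧ g ∉ Set.range (Function.const A) := by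
  classical
  let s : Finset (Colex (Finset A) ×ₗ Colex (Finset A)) := (Finset.univ.filter fun g : A → Fin 3 =>
      IsGood G R g ∧ g ∉ Set.range (Function.const A)).image letterKey
  refine ⟨s.sort.map (Function.invFun letterKey), ?_, fun g => ?_⟩
  · rw [List.pairwise_map]
    refine List.Pairwise.imp_of_mem ?_ (Finset.sortedLT_sort s).pairwise
    intro a b ha hb hab
    rw [Finset.mem_sort, Finset.mem_image] at ha hb
    obtain ⟨g, -, rfl⟩ := ha
    obtain ⟨h, -, rfl⟩ := hb
    rwa [Function.leftInverse_invFun letterKey_injective,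
      Function.leftInverse_invFun letterKey_injective]
  · simp only [List.mem_map, Finset.mem_sort, s, Finset.mem_image, Finset.mem_filter,
      Finset.mem_univ, true_and]
    constructor
    · rintro ⟨_, ⟨h, hh, rfl⟩, rfl⟩
      rwa [Function.leftInverse_invFun letterKey_injective]
    · exact fun hg => ⟨_, ⟨g, hg, rfl⟩, Function.leftInverse_invFun letterKey_injective g⟩

end Letters

/-- A criterion for lexicographic comparison that does not mention the first difference: a
difference in the wrong direction is always preceded by some other difference. -/
theorem map_lt_map_of_first {β γ δ : Type} [LinearOrder γ] [LinearOrder δ] (key : β → δ)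
    (f f' : β → γ) (l : List β) (hl : l.Pairwise fun x y => key x < key y)
    (hne : ∃ g ∈ l, f g ≠ f' g)
    (h : ∀ g ∈ l, f' g < f g → ∃ g' ∈ l, key g' < key g ∧ f g' ≠ f' g') :
    l.map f < l.map f' := by
  induction l with
  | nil => simp at hne
  | cons a l ih =>
    rw [List.pairwise_cons] at hl
    rw [List.map_cons, List.map_cons, List.cons_lt_cons_iff]
    rcases lt_trichotomy (f a) (f' a) with h1 | h1 | h1
    · exact Or.inl h1
    · refine Or.inr ⟨h1, ih hl.2 ?_ ?_⟩
      · obtain ⟨g, hg, hg'⟩ := hne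
        rcases List.mem_cons.1 hg with rfl | hg
        · exact absurd h1 hg'
        · exact ⟨g, hg, hg'⟩
      · intro g hg hlt
        obtain ⟨g', hg', h2, h3⟩ := h g (List.mem_cons_of_mem _ hg) hlt
        rcases List.mem_cons.1 hg' with rfl | hg'
        · exact absurd h1 h3
        · exact ⟨g', hg', h2, h3⟩
    · obtain ⟨g', hg', h2, -⟩ := h a List.mem_cons_self h1
      rcases List.mem_cons.1 hg' with rfl | hg'
      · exact absurd h2 (lt_irrefl _)
      · exact absurd (hl.1 g' hg') h2.not_gt

/-! ### Representation by words -/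

section Representation

variable {A : Type} [LinearOrder A] {G : Digraph A} {R : A → A → Prop} {l : List (A → Fin 3)}

/-- The word of the letters that the assignments in the list `l` give to the point `a`. -/
def codeWord (l : List (A → Fin 3)) (a : A) : Word l.length :=
  ⟨l.map fun g => g a, List.length_map _⟩

/-- Two parts are told apart by the assignment of `0` to one of them and `2` to all other points. -/
theorem exists_mem_part (hA : IsStarModel G R (· < ·))
    (hmem : ∀ g, g ∈ l ↔ IsGood G R g ∧ g ∉ Set.range (Function.const A))
    {x y : A} (hxy : ¬ NonEdge G x y) :
    ∃ g ∈ l, (∀ a, g a = 0 ↔ NonEdge G x a) ∧ ∀ a, g a ≠ 1 := by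
  classical
  refine ⟨fun a => if NonEdge G x a then 0 else 2, (hmem _).2 ⟨⟨?_, ?_⟩, ?_⟩, ?_, ?_⟩
  · intro a b hab
    by_cases ha : NonEdge G x a <;> by_cases hb : NonEdge G x b <;> simp [ha, hb]
    exact hb (hA.nonEdge_equiv.trans ha hab)
  · intro a b _ hb
    by_cases hb' : NonEdge G x b <;> simp [hb'] at hb
  · rintro ⟨s, hs⟩
    have h1 := congrFun hs x
    have h2 := congrFun hs y
    simp [hA.nonEdge_equiv.refl x, hxy] at h1 h2
    simp [h1] at h2
  · intro a
    by_cases ha : NonEdge G x a <;> simp [ha]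
  · intro a
    by_cases ha : NonEdge G x a <;> simp [ha]

theorem partKey_codeWord_eq (hA : IsStarModel G R (· < ·))
    (hmem : ∀ g, g ∈ l ↔ IsGood G R g ∧ g ∉ Set.range (Function.const A)) (x y : A) :
    partKey (codeWord l x).1 = partKey (codeWord l y).1 ↔ NonEdge G x y := by
  simp only [codeWord, partKey, List.map_map, List.map_inj_left, Function.comp, ne_eq,
    decide_eq_decide, not_iff_not]
  constructor
  · intro h
    by_contra hxy
    obtain ⟨g, hg, h0, -⟩ := exists_mem_part hA hmem hxy
    exact hxy ((h0 y).1 ((h g hg).1 ((h0 x).2 (hA.nonEdge_equiv.refl x))))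
  · intro h g hg
    have hgood := ((hmem g).1 hg).1
    exact ⟨hgood.closed x y h, hgood.closed y x (hA.nonEdge_equiv.symm h)⟩

theorem wordSub_codeWord (hA : IsStarModel G R (· < ·))
    (hmem : ∀ g, g ∈ l ↔ IsGood G R g ∧ g ∉ Set.range (Function.const A)) (x u : A) :
    wordSub (codeWord l x) (codeWord l u) ↔ R x u := by
  classical
  rw [wordSub, ne_eq, partKey_codeWord_eq hA hmem]
  simp only [HasLabel, codeWord, partKey, List.map_map, List.zip_map', List.mem_map,
    Function.comp, Prod.mk.injEq, decide_eq_false_iff_not, not_not]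
  constructor
  · rintro ⟨-, g, hg, h0, h1⟩
    exact ((hmem g).1 hg).1.sub x u h0 h1
  · intro h
    have hxu := hA.not_nonEdge_of_sub x u h
    refine ⟨hxu, fun a => if NonEdge G x a then 0 else if a = u then 1 else 2,
      (hmem _).2 ⟨⟨?_, ?_⟩, ?_⟩, ?_, ?_⟩
    · intro a b hab ha
      have ha' : NonEdge G x a := by
        by_contra ha'
        by_cases hau : a = u <;> simp [ha', hau, hxu] at ha
      simp [hA.nonEdge_equiv.trans ha' hab]
    · intro a b ha hb
      have ha' : NonEdge G x a := by
        by_contra ha'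
        by_cases hau : a = u <;> simp [ha', hau, hxu] at ha
      have hb' : b = u := by
        by_contra hbu
        by_cases hb' : NonEdge G x b <;> simp [hb', hbu] at hb
      exact hb' ▸ hA.sub_congr x a u ha' h
    · rintro ⟨s, hs⟩
      have h1 := congrFun hs x
      have h2 := congrFun hs u
      simp [hA.nonEdge_equiv.refl x, hxu] at h1 h2
      simp [h1] at h2
    · simp [hA.nonEdge_equiv.refl x]
    · simp [hxu]

/-- The order is represented correctly. For `x < y` in different parts, the assignment with `0` on
the part of `x` only precedes every assignment with `0` at `y` and not at `x`; within a part, the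
assignment with `1` at `x` only precedes every assignment with `1` at `y` and not at `x`. -/
theorem codeWord_strictMono [Fintype A] (hA : IsStarModel G R (· < ·))
    (hl : l.Pairwise fun g h => letterKey g < letterKey h)
    (hmem : ∀ g, g ∈ l ↔ IsGood G R g ∧ g ∉ Set.range (Function.const A)) :
    StrictMono (codeWord l) := by
  classical
  intro x y hxy
  rw [Word.lt_iff, partKey_codeWord_eq hA hmem]
  by_cases hne : NonEdge G x y
  · refine Or.inr ⟨hne, ?_⟩
    let g' : A → Fin 3 := fun a => if a = x then 1 else 2
    have hg' : g' ∈ l := by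
      refine (hmem _).2 ⟨⟨fun a b _ ha => ?_, fun a b ha => ?_⟩, ?_⟩
      · by_cases h : a = x <;> simp [g', h] at ha
      · by_cases h : a = x <;> simp [g', h] at ha
      · rintro ⟨s, hs⟩
        have h1 := congrFun hs x
        have h2 := congrFun hs y
        simp [g', hxy.ne'] at h1 h2
        simp [h1] at h2
    refine map_lt_map_of_first letterKey _ _ l hl ⟨g', hg', by simp [g', hxy.ne']⟩ ?_
    intro g hg hlt
    refine ⟨g', hg', ?_, by simp [g', hxy.ne']⟩
    have hgood := ((hmem g).1 hg).1
    have hx0 : g x ≠ 0 := fun h => by simp [h] at hlt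
    have hy1 : g y = 1 := by
      rcases fin_three_cases (g y) with h | h | h
      · exact absurd (hgood.closed y x (hA.nonEdge_equiv.symm hne) h) hx0
      · exact h
      · rw [h] at hlt
        exact absurd hlt (not_lt.2 (Fin.le_last (g x)))
    have hg0 : ∀ a, g' a ≠ 0 := by
      intro a
      by_cases h : a = x <;> simp [g', h]
    rw [letterKey_lt]
    by_cases h : ∃ a, g a = 0
    · obtain ⟨a, ha⟩ := h
      exact Or.inl ⟨a, ha, hg0 a, fun b hb => absurd hb (hg0 b)⟩
    · push Not at h
      refine Or.inr ⟨fun a => ⟨fun h' => absurd h' (hg0 a), fun h' => absurd h' (h a)⟩, y, hy1,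
        by simp [g', hxy.ne'], fun b hb _ => ?_⟩
      by_cases hbx : b = x
      · exact hbx ▸ hxy
      · simp [g', hbx] at hb
  · refine Or.inl ?_
    obtain ⟨g', hg', h0, -⟩ := exists_mem_part hA hmem hne
    have hx0 := (h0 x).2 (hA.nonEdge_equiv.refl x)
    have hy0 : g' y ≠ 0 := fun h => hne ((h0 y).1 h)
    simp only [codeWord, partKey, List.map_map]
    refine map_lt_map_of_first letterKey _ _ l hl ⟨g', hg', by simp [hx0, hy0]⟩ ?_
    intro g hg hlt
    refine ⟨g', hg', ?_, by simp [hx0, hy0]⟩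
    have hy : g y = 0 := by
      by_contra h
      simp only [Function.comp, ne_eq, h, not_false_eq_true, decide_true] at hlt
      exact absurd hlt (not_lt.2 (Bool.le_true _))
    refine letterKey_lt.2 (Or.inl ⟨y, hy, hy0, fun b hb _ => ?_⟩)
    exact hA.order.lt_of_lt hA.nonEdge_equiv ((h0 b).1 hb) (hA.nonEdge_equiv.refl y) hne hxy

end Representation

/-! ### Restriction to a substructure -/

section Extension

variable {A B : Type} [LinearOrder A] [Fintype A] [LinearOrder B] [Fintype B]
  {G : Digraph A} {R : A → A → Prop} {G' : Digraph B} {R' : B → B → Prop}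

/-- A good assignment `h` on a substructure has a least good extension: it uses the letter `0` on
the parts on which `h` uses it, the letters of `h` at the other points of the substructure, and the
letter `2` elsewhere. It precedes every good assignment whose restriction comes after `h`. -/
theorem exists_isGood_extension (hB : IsStarModel G' R' (· < ·)) (φ : A → B)
    (hφ : Function.Injective φ)
    (hlt : ∀ x y, φ x < φ y ↔ x < y)
    (hne : ∀ x y, NonEdge G' (φ x) (φ y) ↔ NonEdge G x y)
    (hR : ∀ x y, R' (φ x) (φ y) ↔ R x y) {h : A → Fin 3} (hh : IsGood G R h) :
    ∃ h₀ : B → Fin 3, IsGood G' R' h₀ ∧ h₀ ∘ φ = h ∧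
      ∀ g, IsGood G' R' g → letterKey h < letterKey (g ∘ φ) → letterKey h₀ < letterKey g := by
  classical
  let h₀ : B → Fin 3 := fun b => if ∃ a, NonEdge G' (φ a) b ∧ h a = 0 then 0 else
    if ∃ a, φ a = b ∧ h a = 1 then 1 else 2
  have heq := hB.nonEdge_equiv
  have h0 : ∀ b, h₀ b = 0 ↔ ∃ a, NonEdge G' (φ a) b ∧ h a = 0 := by
    intro b
    simp only [h₀]
    split_ifs <;> simp_all
  have h1 : ∀ b, h₀ b = 1 ↔ ∃ a, φ a = b ∧ h a = 1 := by
    intro b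
    simp only [h₀]
    split_ifs with h2 h3
    · simp only [Fin.isValue, zero_ne_one, false_iff]
      rintro ⟨a, rfl, ha⟩
      obtain ⟨a', ha', h0⟩ := h2
      rw [hh.closed a' a ((hne _ _).1 ha') h0] at ha
      simp at ha
    · simpa using h3
    · simpa using h3
  have hφ0 : ∀ a, h₀ (φ a) = 0 ↔ h a = 0 := by
    intro a
    rw [h0]
    exact ⟨fun ⟨a', ha', h⟩ => hh.closed a' a ((hne _ _).1 ha') h,
      fun h => ⟨a, heq.refl _, h⟩⟩
  have hφ1 : ∀ a, h₀ (φ a) = 1 ↔ h a = 1 := by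
    intro a
    rw [h1]
    exact ⟨fun ⟨a', ha', h⟩ => hφ ha' ▸ h, fun h => ⟨a, rfl, h⟩⟩
  refine ⟨h₀, ⟨?_, ?_⟩, ?_, ?_⟩
  · intro x y hxy hx
    obtain ⟨a, ha, ha0⟩ := (h0 x).1 hx
    exact (h0 y).2 ⟨a, heq.trans ha hxy, ha0⟩
  · intro x u hx hu
    obtain ⟨a, ha, ha0⟩ := (h0 x).1 hx
    obtain ⟨b, rfl, hb1⟩ := (h1 u).1 hu
    exact hB.sub_congr _ _ _ ha ((hR _ _).2 (hh.sub a b ha0 hb1))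
  · funext a
    have h2 := hφ0 a
    have h3 := hφ1 a
    simp only [Function.comp]
    rcases fin_three_cases (h₀ (φ a)) with h4 | h4 | h4 <;>
      rcases fin_three_cases (h a) with h5 | h5 | h5 <;> simp_all
  · intro g hg hlt'
    rw [letterKey_lt] at hlt' ⊢
    simp only [Function.comp] at hlt'
    rcases hlt' with ⟨e, he0, he, hmax⟩ | ⟨hpart, e, he1, he, hmax⟩
    · refine Or.inl ⟨φ e, he0, fun h => he ((hφ0 e).1 h), fun d hd hgd => ?_⟩
      obtain ⟨a, ha, ha0⟩ := (h0 d).1 hd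
      have hga : g (φ a) ≠ 0 := fun h => hgd (hg.closed _ _ ha h)
      refine hB.order.lt_of_lt heq ha (heq.refl _) (fun h => ?_) ((hlt _ _).2 (hmax a ha0 hga))
      exact hga (hg.closed _ _ (heq.symm h) he0)
    · -- the part letters of `h₀` are then among those of `g`
      have hsub : ∀ d, h₀ d = 0 → g d = 0 := by
        intro d hd
        obtain ⟨a, ha, ha0⟩ := (h0 d).1 hd
        exact hg.closed _ _ ha ((hpart a).1 ha0)
      by_cases hall : ∀ d, g d = 0 → h₀ d = 0
      · refine Or.inr ⟨fun d => ⟨hsub d, hall d⟩, φ e, he1, fun h => he ((hφ1 e).1 h),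
          fun d hd hgd => ?_⟩
        obtain ⟨a, rfl, ha1⟩ := (h1 d).1 hd
        exact (hlt _ _).2 (hmax a ha1 hgd)
      · push Not at hall
        obtain ⟨d, hd, hd'⟩ := hall
        exact Or.inl ⟨d, hd, hd', fun b hb hgb => absurd (hsub b hb) hgb⟩

/-- The representation of `B` restricted to a copy of `A` arises from the representation of `A` by
the action of a parameter word. -/
theorem exists_act_eq_comp (hB : IsStarModel G' R' (· < ·)) (φ : A → B)
    (hφ : Function.Injective φ)
    (hlt : ∀ x y, φ x < φ y ↔ x < y)
    (hne : ∀ x y, NonEdge G' (φ x) (φ y) ↔ NonEdge G x y)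
    (hR : ∀ x y, R' (φ x) (φ y) ↔ R x y)
    {l : List (A → Fin 3)} (hl : l.Pairwise fun g h => letterKey g < letterKey h)
    (hmem : ∀ g, g ∈ l ↔ IsGood G R g ∧ g ∉ Set.range (Function.const A))
    {l' : List (B → Fin 3)} (hl' : l'.Pairwise fun g h => letterKey g < letterKey h)
    (hmem' : ∀ g, g ∈ l' ↔ IsGood G' R' g ∧ g ∉ Set.range (Function.const B)) :
    ∃ W : ParamWord (Fin 3) l'.length l.length,
      W.act (Function.const A) l = l'.map fun g => g ∘ φ := by
  have hres : ∀ g, IsGood G' R' g → IsGood G R (g ∘ φ) := fun g hg =>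
    ⟨fun x y hxy => hg.closed _ _ ((hne _ _).2 hxy), fun x u hx hu => (hR _ _).1 (hg.sub _ _ hx hu)⟩
  have hext : ∀ h, IsGood G R h → h ∉ Set.range (Function.const A) → ∃ h₀ ∈ l', h₀ ∘ φ = h ∧
      ∀ g ∈ l', letterKey h < letterKey (g ∘ φ) → letterKey h₀ < letterKey g := by
    intro h hh hc
    obtain ⟨h₀, h1, h2, h3⟩ := exists_isGood_extension hB φ hφ hlt hne hR hh
    refine ⟨h₀, (hmem' h₀).2 ⟨h1, ?_⟩, h2, fun g hg => h3 g ((hmem' g).1 hg).1⟩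
    rintro ⟨s, rfl⟩
    exact hc ⟨s, h2⟩
  obtain ⟨m, W, k, hkm, hW, hk, hkmem⟩ := ParamWord.exists_act_eq letterKey
    (letterKey_injective (A := A)) (Function.const A) (l'.map fun g => g ∘ φ) (by
      intro l₁ x l₂ heq y hy hyx
      by_cases hc : y ∈ Set.range (Function.const A)
      · exact Or.inr hc
      · left
        obtain ⟨q₁, q₂, rfl, rfl, hq⟩ := List.map_eq_append_iff.1 heq
        obtain ⟨g, q₃, rfl, rfl, rfl⟩ := List.map_eq_cons_iff.1 hq
        obtain ⟨h, hh, rfl⟩ := List.mem_map.1 hy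
        obtain ⟨h₀, hmem₀, hcomp, hmin⟩ := hext (h ∘ φ)
          (hres h ((hmem' h).1 (by simp [hh])).1) hc
        have hlt₀ := hmin g (by simp) hyx
        refine List.mem_map.2 ⟨h₀, ?_, hcomp⟩
        rcases List.mem_append.1 hmem₀ with h1 | h1
        · exact h1
        · exfalso
          have hp := (List.pairwise_append.1 hl').2.1
          rcases List.mem_cons.1 h1 with rfl | h1
          · exact lt_irrefl _ hlt₀
          · exact lt_asymm hlt₀ ((List.pairwise_cons.1 hp).1 _ h1))
  have hkl : k = l := by
    have hmem_iff : ∀ g, g ∈ k ↔ g ∈ l := by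
      intro g
      rw [hkmem, hmem, List.mem_map]
      refine and_congr_left fun hc => ⟨?_, fun hg => ?_⟩
      · rintro ⟨g, hg, rfl⟩
        exact hres g ((hmem' g).1 hg).1
      · obtain ⟨h₀, h1, h2, -⟩ := hext g hg hc
        exact ⟨h₀, h1, h2⟩
    have hnodup : ∀ {l : List (A → Fin 3)}, (l.Pairwise fun g h => letterKey g < letterKey h) →
        l.Nodup := fun h => h.imp fun hab he => hab.ne (congrArg letterKey he)
    refine List.Perm.eq_of_pairwise (fun a b _ _ h1 h2 => absurd h2 h1.not_gt) hk hl
      ((List.perm_ext_iff_of_nodup (hnodup hk) (hnodup hl)).2 hmem_iff)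
  subst hkl
  subst hkm
  have hlen : ∀ N, (l'.map fun g => g ∘ φ).length = N →
      ∃ W : ParamWord (Fin 3) N k.length, W.act (Function.const A) k = l'.map fun g => g ∘ φ := by
    rintro _ rfl
    exact ⟨W, hW⟩
  exact hlen _ (List.length_map _)

end Extension

end Semigeneric

/-! ### The partition property -/

namespace Semigeneric

theorem finite_and_isStarModel_of_mem_age {A : Bundled.{0} starLang.Structure}
    (hA : A ∈ ageOfClass SStar) :
    Finite A ∧ IsStarModel (edgeGraph A) (subRel A) (ltRel A) := by
  obtain ⟨hfin, B, ⟨k, hB⟩, ⟨f⟩⟩ := hA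
  exact ⟨hfin, hB.isStarModel.comap f f.injective (rel_iff_of_embedding f StarRel.edge)
    (rel_iff_of_embedding f StarRel.sub) (rel_iff_of_embedding f StarRel.lt)⟩

theorem word_mem_age (N : ℕ) : Bundled.of (c := starLang.Structure) (Word N) ∈ ageOfClass SStar :=
  ⟨inferInstanceAs (Finite (Word N)), Bundled.of (c := starLang.Structure) (Word N),
    exists_isExpansion_word N, ⟨FirstOrder.Language.Embedding.refl starLang (Word N)⟩⟩

/-- The linear order of a model of the axioms. -/
noncomputable abbrev IsStarModel.linearOrder {A : Type} {G : Digraph A} {R lt : A → A → Prop}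
    (h : IsStarModel G R lt) : LinearOrder A :=
  letI := Classical.decRel lt
  haveI : IsStrictTotalOrder A lt :=
    { irrefl := h.order.irrefl
      trans := h.order.trans
      trichotomous := fun a b h1 h2 => ((h.order.total a b).resolve_left h1).resolve_right h2 }
  linearOrderOfSTO lt

/-- Substitution into a parameter word embeds the words of length `m` into those of length `N`. -/
noncomputable def actEmbedding {N m : ℕ} (W : ParamWord (Fin 3) N m) : Word m ↪[starLang] Word N :=
  starEmbedding (isStarModel_word m) (isStarModel_word N) (actWord W)
    (fun x y => by rw [nonEdge_word, nonEdge_word]; exact partKey_actWord_eq W x y)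
    (wordSub_actWord W) (actWord_lt W)

/-- There are representations of `A` and `B` by words such that each embedding of `A` into `B` is
the action of a parameter word on the representations. -/
theorem exists_codes (A B : Type) [starLang.Structure A] [starLang.Structure B] [Finite A]
    [Finite B] (hA : IsStarModel (edgeGraph A) (subRel A) (ltRel A))
    (hB : IsStarModel (edgeGraph B) (subRel B) (ltRel B)) :
    ∃ (m n : ℕ) (f : A ↪[starLang] Word m) (g : B ↪[starLang] Word n),
      ∀ φ : A ↪[starLang] B, ∃ W : ParamWord (Fin 3) n m, ∀ a, actWord W (f a) = g (φ a) := by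
  have := Fintype.ofFinite A
  have := Fintype.ofFinite B
  let _ := hA.linearOrder
  let _ := hB.linearOrder
  obtain ⟨l, hl, hmem⟩ := exists_list_isGood (edgeGraph A) (subRel A)
  obtain ⟨l', hl', hmem'⟩ := exists_list_isGood (edgeGraph B) (subRel B)
  refine ⟨l.length, l'.length,
    starEmbedding hA (isStarModel_word _) (codeWord l)
      (fun x y => by rw [nonEdge_word]; exact partKey_codeWord_eq hA hmem x y)
      (wordSub_codeWord hA hmem) (fun _ _ => (codeWord_strictMono hA hl hmem).lt_iff_lt),
    starEmbedding hB (isStarModel_word _) (codeWord l')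
      (fun x y => by rw [nonEdge_word]; exact partKey_codeWord_eq hB hmem' x y)
      (wordSub_codeWord hB hmem') (fun _ _ => (codeWord_strictMono hB hl' hmem').lt_iff_lt),
    fun φ => ?_⟩
  have hE : ∀ x y, (edgeGraph A).Adj x y ↔ (edgeGraph B).Adj (φ x) (φ y) :=
    rel_iff_of_embedding φ StarRel.edge
  obtain ⟨W, hW⟩ := exists_act_eq_comp hB φ φ.injective
    (fun x y => (rel_iff_of_embedding φ StarRel.lt x y).symm)
    (fun x y => by simp only [NonEdge, hE])
    (fun x y => (rel_iff_of_embedding φ StarRel.sub x y).symm) hl hmem hl' hmem'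
  refine ⟨W, fun a => Subtype.ext ?_⟩
  have h := congrArg (List.map fun g : A → Fin 3 => g a) hW
  rw [ParamWord.map_act, List.map_map] at h
  exact h

/-- The partition property, from the Graham–Rothschild theorem: a parameter word is coloured by the
colour of the copy of `A` that it yields from the representation of `A`. -/
theorem arrows_word {A B : Type} [starLang.Structure A] [starLang.Structure B] [Finite A]
    [Finite B] (hA : IsStarModel (edgeGraph A) (subRel A) (ltRel A))
    (hB : IsStarModel (edgeGraph B) (subRel B) (ltRel B)) (k : ℕ) :
    ∃ N, Arrows starLang (Word N) B A k := by
  obtain ⟨m, n, f, g, hfg⟩ := exists_codes A B hA hB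
  -- one more colour than needed, as the theorem requires a nonempty set of colours
  obtain ⟨N, hN⟩ := ParamWord.graham_rothschild m (Fin 3) (ULift.{1} (Fin (k + 1))) n
  refine ⟨N, fun c => ?_⟩
  let copy : ParamWord (Fin 3) N m → Copies starLang (Word N) A := fun W =>
    ⟨((actEmbedding W).comp f).toHom.range, ⟨((actEmbedding W).comp f).equivRange.symm⟩⟩
  obtain ⟨W, k₀, hW⟩ := hN fun V => ⟨(c (copy V)).castSucc⟩
  let F : B ↪[starLang] Word N := (actEmbedding W).comp g
  refine ⟨⟨F.toHom.range, ⟨F.equivRange.symm⟩⟩, ?_⟩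
  have key : ∀ A₁ : Copies starLang (Word N) A, A₁.1 ≤ F.toHom.range →
      (c A₁).castSucc = k₀.down := by
    rintro ⟨D, ⟨e⟩⟩ hD
    let φ : A ↪[starLang] B := F.equivRange.symm.toEmbedding.comp
      ((FirstOrder.Language.Substructure.inclusion hD).comp e.symm.toEmbedding)
    obtain ⟨V, hV⟩ := hfg φ
    have hφ : ∀ a, F (φ a) = e.symm a := by
      intro a
      have h := F.equivRange.apply_symm_apply
        (FirstOrder.Language.Substructure.inclusion hD (e.symm a))
      exact congrArg Subtype.val h
    have hcopy : copy (ParamWord.subst id W V) = ⟨D, ⟨e⟩⟩ := by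
      refine Subtype.ext (FirstOrder.Language.Substructure.ext fun x => ?_)
      have hval : ∀ a, ((actEmbedding (ParamWord.subst id W V)).comp f) a = e.symm a := by
        intro a
        rw [← hφ]
        refine Subtype.ext ?_
        refine (ParamWord.act_subst id id W V (f a).1).trans ?_
        exact congrArg (fun w => W.act id w) (congrArg Subtype.val (hV a))
      constructor
      · rintro ⟨a, rfl⟩
        exact (hval a).symm ▸ (e.symm a).2
      · intro hx
        refine ⟨e ⟨x, hx⟩, (hval _).trans ?_⟩
        rw [e.symm_apply_apply]
    have := hW V
    rw [hcopy] at this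
    exact congrArg ULift.down this
  intro A₁ A₂ h₁ h₂
  exact Fin.castSucc_injective _ ((key A₁ h₁).trans (key A₂ h₂).symm)

end Semigeneric

theorem mainTheorem1 :
    Semigeneric.HasRamseyProperty (Semigeneric.ageOfClass Semigeneric.SStar) := by
  intro k A hA B hB
  obtain ⟨hA₁, hA₂⟩ := Semigeneric.finite_and_isStarModel_of_mem_age hA
  obtain ⟨hB₁, hB₂⟩ := Semigeneric.finite_and_isStarModel_of_mem_age hB
  obtain ⟨N, hN⟩ := Semigeneric.arrows_word hA₂ hB₂ k
  exact ⟨_, Semigeneric.word_mem_age N, hN⟩
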